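/- Let $\mathbb{K}$ be an algebraically closed field of characteristic $0$, and let $p\in\mathbb{K}[x,y]\setminus(\mathbb{K}[x]\cup\mathbb{K}[y])$ be irreducible. Let $\mathbb{K}[x,y]_p\subseteq\mathbb{K}(x,y)$ be the local ring of rational functions whose denominator is not divisible by $p$, let $\langle p\rangle$ be the ideal of $\mathbb{K}[x,y]_p$ generated by $p$, and let $$\mathrm{F}(p)=\{(f,g)\in\mathbb{K}(x)\times\mathbb{K}(y) : f-g\in\langle p\rangle\},$$ which is a field with respect to componentwise operations and contains $\mathbb{K}$ diagonally. A generator of $\mathrm{F}(p)$ is an element $(f,g)\in \mathrm{F}(p)$ with $\mathrm{F}(p)=\mathbb{K}((f,g))$. A point $s\in\mathbb{K}$ is a pole of a univariate rational function (in reduced form) if it is a root of its denominator, and $\infty$ is a pole if the degree of the numerator exceeds the degree of the denominator. Identify $\mathbb{K}\cup\{\infty\}$ with $\mathbb{P}^1(\mathbb{K})$ via $s=[1:s]$ and $\infty=[0:1]$. Let $C\subseteq\mathbb{P}^1(\mathbb{K})\times\mathbb{P}^1(\mathbb{K})$ be the curve defined by the bi-homogenization $x_0^{\deg_x p}\,y_0^{\deg_y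 p}\,p(x_1/x_0,y_1/y_0)$ of $p$, and let $\sim$ be the smallest equivalence relation on $C$ such that $(a_0,b_0)\sim(a_1,b_1)$ whenever $a_0=a_1$ or $b_0=b_1$. Let $\mathcal{O}$, the orbit at $\infty$, be the equivalence class of the points of $C$ whose first coordinate is $\infty$ (these points are all equivalent). **Theorem.** Assume that $\mathrm{F}(p)\ncong\mathbb{K}$. Then there is a generator $(f,g)$ of $\mathrm{F}(p)$ such that, for every $(a,b)\in\mathcal{O}$, $a$ is a pole of $f$ and $b$ is a pole of $g$. In particular, $\mathcal{O}$ is finite. -/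

import Mathlib

namespace SepVar

open MvPolynomial

/-- The standing assumption on a bivariate polynomial `p ∈ K[x,y]` (variables `x = X 0` and
`y = X 1`): it is irreducible and lies neither in `K[x]` nor in `K[y]`. -/
structure Admissible {K : Type*} [Field K] (p : MvPolynomial (Fin 2) K) : Prop where
  irreducible : Irreducible p
  notMem_x : p ∉ supported K ({0} : Set (Fin 2))
  notMem_y : p ∉ supported K ({1} : Set (Fin 2))

/-- The field `K(x,y)`. -/
abbrev RatFunc₂ (K : Type*) [Field K] : Type _ := FractionRing (MvPolynomial (Fin 2) K)

/-- The substitution `K[t] → K(x,y)`, `t ↦ x` (if `i = 0`) or `t ↦ y` (if `i = 1`). -/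
noncomputable def polyIncl (K : Type*) [Field K] (i : Fin 2) : Polynomial K →ₐ[K] RatFunc₂ K :=
  (Algebra.algHom K (MvPolynomial (Fin 2) K) (RatFunc₂ K)).comp (Polynomial.aeval (X i))

theorem polyIncl_apply {K : Type*} [Field K] (i : Fin 2) (a : Polynomial K) :
    polyIncl K i a
      = algebraMap (MvPolynomial (Fin 2) K) (RatFunc₂ K) (Polynomial.aeval (X i) a) := rfl

theorem polyIncl_injective (K : Type*) [Field K] (i : Fin 2) :
    Function.Injective (polyIncl K i) := by
  have h1 : Function.Injective
      (Polynomial.aeval (X i : MvPolynomial (Fin 2) K) : Polynomial K →ₐ[K] _) :=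
    transcendental_iff_injective.1 (transcendental_X K i)
  intro a b hab
  exact h1 (IsFractionRing.injective (MvPolynomial (Fin 2) K) (RatFunc₂ K) hab)

/-- The embedding of `K(t)` into `K(x,y)` with image `K(x)` (if `i = 0`) or `K(y)` (if `i = 1`). -/
noncomputable def incl (K : Type*) [Field K] (i : Fin 2) : RatFunc K →ₐ[K] RatFunc₂ K :=
  RatFunc.liftAlgHom (polyIncl K i)
    (nonZeroDivisors_le_comap_nonZeroDivisors_of_injective _ (polyIncl_injective K i))

/-- The local ring `K[x,y]_p` of all rational functions whose denominator is not divisible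
by `p`. -/
noncomputable def localRing {K : Type*} [Field K] {p : MvPolynomial (Fin 2) K}
    (hp : Admissible p) : Subalgebra K (RatFunc₂ K) where
  carrier := {r | ∃ a b : MvPolynomial (Fin 2) K, ¬ p ∣ b ∧
    r = algebraMap _ (RatFunc₂ K) a / algebraMap _ (RatFunc₂ K) b}
  mul_mem' := by
    rintro _ _ ⟨a, b, hb, rfl⟩ ⟨c, d, hd, rfl⟩
    refine ⟨a * c, b * d, fun h => (hp.irreducible.prime.dvd_or_dvd h).elim hb hd, ?_⟩
    rw [map_mul, map_mul, div_mul_div_comm]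
  add_mem' := by
    rintro _ _ ⟨a, b, hb, rfl⟩ ⟨c, d, hd, rfl⟩
    refine ⟨a * d + b * c, b * d,
      fun h => (hp.irreducible.prime.dvd_or_dvd h).elim hb hd, ?_⟩
    have hb0 : algebraMap _ (RatFunc₂ K) b ≠ 0 := by
      simpa using fun h : b = 0 => hb (h ▸ dvd_zero p)
    have hd0 : algebraMap _ (RatFunc₂ K) d ≠ 0 := by
      simpa using fun h : d = 0 => hd (h ▸ dvd_zero p)
    rw [div_add_div _ _ hb0 hd0]
    simp only [map_mul, map_add]
  algebraMap_mem' := by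
    intro r
    refine ⟨C r, 1, fun h => hp.irreducible.not_isUnit (isUnit_of_dvd_one h), ?_⟩
    rw [map_one, div_one]
    rfl

/-- `p` divides no nonzero univariate polynomial. -/
theorem Admissible.not_dvd_aeval_X {K : Type*} [Field K] {p : MvPolynomial (Fin 2) K}
    (hp : Admissible p) (i : Fin 2) {a : Polynomial K} (ha : a ≠ 0) :
    ¬ p ∣ Polynomial.aeval (X i) a := by
  rintro ⟨q, hq⟩
  have hinj : Function.Injective
      (Polynomial.aeval (X i : MvPolynomial (Fin 2) K) : Polynomial K →ₐ[K] _) :=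
    transcendental_iff_injective.1 (transcendental_X K i)
  have hne : p * q ≠ 0 := hq ▸ (map_ne_zero_iff _ hinj).2 ha
  have hmem : p * q ∈ supported K ({i} : Set (Fin 2)) := by
    rw [← hq, supported_eq_adjoin_X, Set.image_singleton]
    exact Polynomial.aeval_mem_adjoin_singleton K _
  have hsub : p ∈ supported K ({i} : Set (Fin 2)) := by
    rw [mem_supported] at hmem ⊢
    intro j hj
    refine hmem ?_
    by_contra hj'
    have h0 : degreeOf j (p * q) = 0 := by
      rw [← Nat.le_zero, degreeOf_le_iff]
      intro m hm
      rw [Nat.le_zero]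
      by_contra hmj
      exact hj' (by
        simp only [Finset.mem_coe, mem_vars_iff_mem_support]
        exact ⟨m, hm, by simpa using hmj⟩)
    rw [degreeOf_mul_eq (left_ne_zero_of_mul hne) (right_ne_zero_of_mul hne)] at h0
    have h1 : degreeOf j p = 0 := by omega
    rw [← Nat.le_zero, degreeOf_le_iff] at h1
    obtain ⟨m, hm, hmj⟩ := (mem_vars_iff_mem_support j).1 (by simpa using hj)
    simp [Nat.le_zero.1 (h1 m hm)] at hmj
  fin_cases i
  · exact hp.notMem_x hsub
  · exact hp.notMem_y hsub

/-- A nonzero univariate rational function is `a / b` with `a`, `b` not divisible by `p`. -/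
theorem Admissible.incl_eq {K : Type*} [Field K] {p : MvPolynomial (Fin 2) K}
    (hp : Admissible p) (i : Fin 2) {f : RatFunc K} (hf : f ≠ 0) :
    ∃ a b : MvPolynomial (Fin 2) K, ¬ p ∣ a ∧ ¬ p ∣ b ∧
      incl K i f = algebraMap _ (RatFunc₂ K) a / algebraMap _ (RatFunc₂ K) b :=
  ⟨_, _, hp.not_dvd_aeval_X i (RatFunc.num_ne_zero hf), hp.not_dvd_aeval_X i f.denom_ne_zero,
    RatFunc.liftAlgHom_apply _ _ f⟩

theorem Admissible.incl_mem {K : Type*} [Field K] {p : MvPolynomial (Fin 2) K}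
    (hp : Admissible p) (i : Fin 2) (f : RatFunc K) : incl K i f ∈ localRing hp := by
  rcases eq_or_ne f 0 with rfl | hf
  · rw [map_zero]
    exact zero_mem _
  · obtain ⟨a, b, -, hb, h⟩ := hp.incl_eq i hf
    exact ⟨a, b, hb, h⟩

/-- The ideal `⟨p⟩` of the local ring `K[x,y]_p` does not contain units `a / b`. -/
theorem Admissible.incl_ne_mul {K : Type*} [Field K] {p : MvPolynomial (Fin 2) K}
    (hp : Admissible p) (i : Fin 2) {f : RatFunc K} (hf : f ≠ 0) {q : RatFunc₂ K}
    (hq : q ∈ localRing hp) : incl K i f ≠ q * algebraMap _ (RatFunc₂ K) p := by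
  obtain ⟨a, b, ha, hb, h⟩ := hp.incl_eq i hf
  obtain ⟨c, d, hd, rfl⟩ := hq
  rw [h]
  intro he
  have hb0 : algebraMap _ (RatFunc₂ K) b ≠ 0 := by
    simpa using fun h : b = 0 => hb (h ▸ dvd_zero p)
  have hd0 : algebraMap _ (RatFunc₂ K) d ≠ 0 := by
    simpa using fun h : d = 0 => hd (h ▸ dvd_zero p)
  rw [div_mul_eq_mul_div, div_eq_div_iff hb0 hd0, ← map_mul, ← map_mul, ← map_mul] at he
  have he' := IsFractionRing.injective (MvPolynomial (Fin 2) K) (RatFunc₂ K) he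
  have hdvd : p ∣ a * d := he' ▸ Dvd.intro_left (c * b) (by ring)
  exact (hp.irreducible.prime.dvd_or_dvd hdvd).elim ha hd

/-- The set `F(p)` of all pairs `(f, g) ∈ K(x) × K(y)` with `f - g ∈ ⟨p⟩`, i.e. `f - g = q p` for
some `q ∈ K[x,y]_p`, with componentwise operations. -/
noncomputable def sepMultiples {K : Type*} [Field K] {p : MvPolynomial (Fin 2) K}
    (hp : Admissible p) : Subalgebra K (RatFunc K × RatFunc K) where
  carrier := {u | ∃ q ∈ localRing hp,
    incl K 0 u.1 - incl K 1 u.2 = q * algebraMap _ (RatFunc₂ K) p}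
  mul_mem' := by
    rintro ⟨f, g⟩ ⟨f', g'⟩ ⟨q, hq, h⟩ ⟨q', hq', h'⟩
    refine ⟨q * incl K 0 f' + incl K 1 g * q',
      add_mem (mul_mem hq (hp.incl_mem 0 f')) (mul_mem (hp.incl_mem 1 g) hq'), ?_⟩
    simp only [Prod.mk_mul_mk, map_mul] at h h' ⊢
    linear_combination incl K 0 f' * h + incl K 1 g * h'
  add_mem' := by
    rintro ⟨f, g⟩ ⟨f', g'⟩ ⟨q, hq, h⟩ ⟨q', hq', h'⟩
    refine ⟨q + q', add_mem hq hq', ?_⟩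
    simp only [Prod.mk_add_mk, map_add] at h h' ⊢
    linear_combination h + h'
  algebraMap_mem' := by
    intro r
    refine ⟨0, zero_mem _, ?_⟩
    rw [Prod.algebraMap_apply, AlgHom.commutes, AlgHom.commutes, sub_self, zero_mul]

theorem sepMultiples_eq_zero_iff {K : Type*} [Field K] {p : MvPolynomial (Fin 2) K}
    {hp : Admissible p} {u : RatFunc K × RatFunc K} (hu : u ∈ sepMultiples hp) :
    u.1 = 0 ↔ u.2 = 0 := by
  obtain ⟨q, hq, h⟩ := hu
  constructor
  · intro h1
    by_contra h2
    refine hp.incl_ne_mul 1 h2 (neg_mem hq) ?_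
    rw [h1, map_zero] at h
    linear_combination -h
  · intro h2
    by_contra h1
    refine hp.incl_ne_mul 0 h1 hq ?_
    rw [h2, map_zero] at h
    linear_combination h

theorem inv_mem_sepMultiples {K : Type*} [Field K] {p : MvPolynomial (Fin 2) K}
    {hp : Admissible p} {u : RatFunc K × RatFunc K} (hu : u ∈ sepMultiples hp) :
    (u.1⁻¹, u.2⁻¹) ∈ sepMultiples hp := by
  rcases eq_or_ne u.1 0 with h1 | h1
  · have h2 := (sepMultiples_eq_zero_iff hu).1 h1
    rw [h1, h2, inv_zero]
    exact zero_mem _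
  · have h2 : u.2 ≠ 0 := fun h => h1 ((sepMultiples_eq_zero_iff hu).2 h)
    obtain ⟨q, hq, h⟩ := hu
    refine ⟨-(incl K 0 u.1⁻¹ * incl K 1 u.2⁻¹ * q),
      neg_mem (mul_mem (mul_mem (hp.incl_mem _ _) (hp.incl_mem _ _)) hq), ?_⟩
    have h1' : incl K 0 u.1 ≠ 0 := (map_ne_zero _).2 h1
    have h2' : incl K 1 u.2 ≠ 0 := (map_ne_zero _).2 h2
    simp only [map_inv₀]
    field_simp
    linear_combination -h

/-- `F(p)` is a field with respect to the componentwise operations. -/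
noncomputable instance {K : Type*} [Field K] {p : MvPolynomial (Fin 2) K} (hp : Admissible p) :
    Field (sepMultiples hp) where
  inv u := ⟨(u.1.1⁻¹, u.1.2⁻¹), inv_mem_sepMultiples u.2⟩
  exists_pair_ne := ⟨0, 1, fun h => by
    have := congrArg (fun u : sepMultiples hp => u.1.1) h
    exact zero_ne_one this⟩
  mul_inv_cancel u hu := by
    have h1 : u.1.1 ≠ 0 := fun h => hu
      (Subtype.ext (Prod.ext h ((sepMultiples_eq_zero_iff u.2).1 h)))
    have h2 : u.1.2 ≠ 0 := fun h => h1 ((sepMultiples_eq_zero_iff u.2).2 h)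
    exact Subtype.ext (Prod.ext (mul_inv_cancel₀ h1) (mul_inv_cancel₀ h2))
  inv_zero := Subtype.ext (Prod.ext inv_zero inv_zero)
  nnqsmul := _
  nnqsmul_def _ _ := rfl
  qsmul := _
  qsmul_def _ _ := rfl

/-- `u = (f, g)` is a generator of `F(p)`: `F(p) = K((f, g))`. -/
def IsGenerator {K : Type*} [Field K] {p : MvPolynomial (Fin 2) K} {hp : Admissible p}
    (u : sepMultiples hp) : Prop :=
  IntermediateField.adjoin K {u} = ⊤

/-- The projective line over `K`, with homogeneous coordinates `[v 0 : v 1]`. -/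
abbrev P1 (K : Type*) [Field K] : Type _ := Projectivization K (Fin 2 → K)

/-- The finite point `s = [1 : s]`. -/
def finPt {K : Type*} [Field K] (s : K) : P1 K :=
  Projectivization.mk K ![1, s] fun h => one_ne_zero (congrFun h 0)

/-- The point `∞ = [0 : 1]`. -/
def inftyPt (K : Type*) [Field K] : P1 K :=
  Projectivization.mk K ![0, 1] fun h => one_ne_zero (congrFun h 1)

/-- A finite point is a pole of `f` if it is a root of the denominator of `f` (in reduced form);
`∞` is a pole of `f` if the degree of the numerator exceeds that of the denominator. -/
def IsPole {K : Type*} [Field K] (f : RatFunc K) (P : P1 K) : Prop :=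
  (∃ s : K, P = finPt s ∧ f.denom.eval s = 0) ∨
    (P = inftyPt K ∧ f.denom.natDegree < f.num.natDegree)

/-- The bi-homogenization `x₀ ^ deg_x p * y₀ ^ deg_y p * p (x₁ / x₀, y₁ / y₀)` of `p`, where
`x₀, x₁, y₀, y₁` are `X (inl 0), X (inl 1), X (inr 0), X (inr 1)`. -/
noncomputable def bihom {K : Type*} [Field K] (p : MvPolynomial (Fin 2) K) :
    MvPolynomial (Fin 2 ⊕ Fin 2) K :=
  ∑ m ∈ p.support, C (coeff m p) *
    (X (Sum.inl 0) ^ (degreeOf 0 p - m 0) * X (Sum.inl 1) ^ m 0) *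
    (X (Sum.inr 0) ^ (degreeOf 1 p - m 1) * X (Sum.inr 1) ^ m 1)

/-- The curve `C` in `ℙ¹ × ℙ¹` defined by the bi-homogenization of `p`. -/
def curve {K : Type*} [Field K] (p : MvPolynomial (Fin 2) K) : Set (P1 K × P1 K) :=
  {P | eval (Sum.elim P.1.rep P.2.rep) (bihom p) = 0}

theorem eval_bihom_smul {K : Type*} [Field K] (p : MvPolynomial (Fin 2) K) (a b : K)
    (v w : Fin 2 → K) :
    eval (Sum.elim (a • v) (b • w)) (bihom p)
      = a ^ degreeOf 0 p * b ^ degreeOf 1 p * eval (Sum.elim v w) (bihom p) := by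
  simp only [bihom, map_sum, map_mul, map_pow, eval_C, eval_X, Sum.elim_inl, Sum.elim_inr,
    Pi.smul_apply, smul_eq_mul, Finset.mul_sum]
  refine Finset.sum_congr rfl fun m hm => ?_
  have h0 : a ^ degreeOf 0 p = a ^ (degreeOf 0 p - m 0) * a ^ m 0 := by
    rw [← pow_add, Nat.sub_add_cancel (monomial_le_degreeOf 0 hm)]
  have h1 : b ^ degreeOf 1 p = b ^ (degreeOf 1 p - m 1) * b ^ m 1 := by
    rw [← pow_add, Nat.sub_add_cancel (monomial_le_degreeOf 1 hm)]
  rw [h0, h1]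
  ring

/-- Membership in the curve does not depend on the choice of homogeneous coordinates. -/
theorem mk_mem_curve {K : Type*} [Field K] (p : MvPolynomial (Fin 2) K) {v w : Fin 2 → K}
    (hv : v ≠ 0) (hw : w ≠ 0) :
    (Projectivization.mk K v hv, Projectivization.mk K w hw) ∈ curve p
      ↔ eval (Sum.elim v w) (bihom p) = 0 := by
  obtain ⟨a, ha⟩ := Projectivization.exists_smul_eq_mk_rep K v hv
  obtain ⟨b, hb⟩ := Projectivization.exists_smul_eq_mk_rep K w hw
  change eval (Sum.elim (Projectivization.mk K v hv).rep (Projectivization.mk K w hw).rep)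
    (bihom p) = 0 ↔ _
  rw [← ha, ← hb, Units.smul_def, Units.smul_def, eval_bihom_smul]
  simp

/-- The smallest equivalence relation on the curve such that two points that agree in the first or
in the second coordinate are equivalent. -/
def OrbitRel {K : Type*} [Field K] (p : MvPolynomial (Fin 2) K) : curve p → curve p → Prop :=
  Relation.EqvGen fun P Q => P.1.1 = Q.1.1 ∨ P.1.2 = Q.1.2

/-- The orbit at `∞`: the equivalence class of the points of the curve whose first coordinate
is `∞` (these are all equivalent). -/
def orbitAtInfty {K : Type*} [Field K] (p : MvPolynomial (Fin 2) K) : Set (P1 K × P1 K) :=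
  {P | ∃ (hP : P ∈ curve p) (Q : curve p), Q.1.1 = inftyPt K ∧ OrbitRel p Q ⟨P, hP⟩}

end SepVar

/-!
The elements `(f, g)` of `F(p)` are the pairs of rational functions that agree on the curve
`p = 0`, so the first projection embeds `F(p)` into `K(x)`, and Lüroth's theorem gives a generator
(`exists_isGenerator`). Since `F(p)` is not `K`, the generator is not constant. If `f` has
a finite value `c` at `∞`, the Möbius transform `1 / ((f, g) - c)` is again a generator, and its
first component has a pole at `∞` (`exists_isGenerator_isPole_inftyPt`).

It remains to see that a pair `(f, g)` in `F(p)` satisfies `f(a) = g(b)` in `ℙ¹` at each point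
`(a, b)` of `C`. Clearing denominators in `f - g ∈ ⟨p⟩`, the polynomial `p` divides
`num f (x) * denom g (y) - num g (y) * denom f (x)` (`dvd_of_mem_sepMultiples`). This divisibility
survives bi-homogenization, so the homogenized difference vanishes on all of `C`, including the
points at infinity (`cross_mul_eq_of_mem_curve`). As the homogenized numerator and denominator of
a rational function have no common zero, `a` is a pole of `f` if and only if `b` is a pole of `g`
(`isPole_iff_of_mem_curve`). Being a pole is thus constant along orbits, and the orbit at `∞`
consists of pairs of poles, of which there are finitely many.
-/

namespace SepVar

open MvPolynomial

/-! ### Bi-homogeneous evaluation -/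

/-- The value at `(v, w)` of the bi-homogenization of a polynomial in bidegree `(k, l)`: it sends
`x ^ i * y ^ j` to `v₀ ^ (k - i) * v₁ ^ i * w₀ ^ (l - j) * w₁ ^ j`. It is meaningful only on
polynomials of degree at most `k` in `x` and at most `l` in `y`, since the subtraction is
truncated. -/
noncomputable def bihomEval {K : Type*} [Field K] (k l : ℕ) (v w : Fin 2 → K) :
    MvPolynomial (Fin 2) K →ₗ[K] K :=
  (basisMonomials (Fin 2) K).constr K fun m =>
    v 0 ^ (k - m 0) * v 1 ^ m 0 * (w 0 ^ (l - m 1) * w 1 ^ m 1)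

theorem bihomEval_monomial {K : Type*} [Field K] (k l : ℕ) (v w : Fin 2 → K) (m : Fin 2 →₀ ℕ)
    (c : K) :
    bihomEval k l v w (monomial m c)
      = c * (v 0 ^ (k - m 0) * v 1 ^ m 0 * (w 0 ^ (l - m 1) * w 1 ^ m 1)) := by
  have h : monomial m c = c • basisMonomials (Fin 2) K m := by
    simp [smul_monomial]
  rw [h, map_smul, bihomEval, Module.Basis.constr_basis, smul_eq_mul]

theorem eval_bihom {K : Type*} [Field K] (p : MvPolynomial (Fin 2) K) (v w : Fin 2 → K) :
    eval (Sum.elim v w) (bihom p) = bihomEval (degreeOf 0 p) (degreeOf 1 p) v w p := by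
  have hp : bihomEval (degreeOf 0 p) (degreeOf 1 p) v w p = ∑ m ∈ p.support,
      bihomEval (degreeOf 0 p) (degreeOf 1 p) v w (monomial m (coeff m p)) := by
    rw [← map_sum, ← p.as_sum]
  rw [hp]
  simp only [bihom, map_sum, map_mul, map_pow, eval_C, eval_X, Sum.elim_inl, Sum.elim_inr,
    bihomEval_monomial, mul_assoc]

theorem bihomEval_mul {K : Type*} [Field K] {k l k' l' : ℕ} (v w : Fin 2 → K)
    {P R : MvPolynomial (Fin 2) K} (hP₀ : degreeOf 0 P ≤ k) (hP₁ : degreeOf 1 P ≤ l)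
    (hR₀ : degreeOf 0 R ≤ k') (hR₁ : degreeOf 1 R ≤ l') :
    bihomEval (k + k') (l + l') v w (P * R)
      = bihomEval k l v w P * bihomEval k' l' v w R := by
  have h : P * R = ∑ m ∈ P.support, ∑ n ∈ R.support,
      monomial (m + n) (coeff m P * coeff n R) := by
    conv_lhs => rw [P.as_sum, R.as_sum, Finset.sum_mul_sum]
    simp only [monomial_mul]
  have hP : bihomEval k l v w P = ∑ m ∈ P.support, bihomEval k l v w (monomial m (coeff m P)) := by
    rw [← map_sum, ← P.as_sum]
  have hR : bihomEval k' l' v w R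
      = ∑ n ∈ R.support, bihomEval k' l' v w (monomial n (coeff n R)) := by
    rw [← map_sum, ← R.as_sum]
  rw [h, hP, hR, Finset.sum_mul_sum]
  simp only [map_sum, bihomEval_monomial, Finsupp.add_apply]
  refine Finset.sum_congr rfl fun m hm => Finset.sum_congr rfl fun n hn => ?_
  have h₀ : k + k' - (m 0 + n 0) = (k - m 0) + (k' - n 0) := by
    have := monomial_le_degreeOf 0 hm
    have := monomial_le_degreeOf 0 hn
    omega
  have h₁ : l + l' - (m 1 + n 1) = (l - m 1) + (l' - n 1) := by
    have := monomial_le_degreeOf 1 hm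
    have := monomial_le_degreeOf 1 hn
    omega
  rw [h₀, h₁]
  ring

/-- The value at `v` of the homogenization of `a` in degree `k`, meaningful if the degree of `a` is
at most `k`. -/
def homEval {K : Type*} [Field K] (k : ℕ) (v : Fin 2 → K) (a : Polynomial K) : K :=
  ∑ i ∈ Finset.range (k + 1), a.coeff i * (v 0 ^ (k - i) * v 1 ^ i)

theorem homEval_finite {K : Type*} [Field K] {k : ℕ} {a : Polynomial K} (ha : a.natDegree ≤ k)
    (s : K) : homEval k ![1, s] a = a.eval s := by
  rw [Polynomial.eval_eq_sum_range' (Nat.lt_succ_of_le ha)]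
  simp [homEval]

theorem homEval_infty {K : Type*} [Field K] (k : ℕ) (a : Polynomial K) :
    homEval k ![0, 1] a = a.coeff k := by
  rw [homEval, Finset.sum_range_succ, Finset.sum_eq_zero]
  · simp
  · intro i hi
    have : k - i ≠ 0 := by
      have := Finset.mem_range.1 hi
      omega
    simp [this]

theorem bihomEval_aeval_mul_aeval {K : Type*} [Field K] {k l : ℕ} (v w : Fin 2 → K)
    {a b : Polynomial K} (ha : a.natDegree ≤ k) (hb : b.natDegree ≤ l) :
    bihomEval k l v w (Polynomial.aeval (X 0) a * Polynomial.aeval (X 1) b)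
      = homEval k v a * homEval l w b := by
  have h : ∀ i j : ℕ, a.coeff i • (X 0 : MvPolynomial (Fin 2) K) ^ i * b.coeff j • X 1 ^ j
      = monomial (Finsupp.single 0 i + Finsupp.single 1 j) (a.coeff i * b.coeff j) := by
    intro i j
    simp only [X_pow_eq_monomial, smul_monomial, monomial_mul, smul_eq_mul, mul_one]
  rw [Polynomial.aeval_eq_sum_range' (Nat.lt_succ_of_le ha),
    Polynomial.aeval_eq_sum_range' (Nat.lt_succ_of_le hb), Finset.sum_mul_sum, homEval, homEval,
    Finset.sum_mul_sum]
  simp only [map_sum, h, bihomEval_monomial]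
  refine Finset.sum_congr rfl fun i _ => Finset.sum_congr rfl fun j _ => ?_
  simp
  ring

theorem degreeOf_aeval_X_le {K : Type*} [Field K] (i : Fin 2) (a : Polynomial K) :
    degreeOf i (Polynomial.aeval (X i : MvPolynomial (Fin 2) K) a) ≤ a.natDegree := by
  rw [Polynomial.aeval_eq_sum_range]
  refine (degreeOf_sum_le _ _ _).trans (Finset.sup_le fun j hj => ?_)
  rw [smul_eq_C_mul]
  refine (degreeOf_C_mul_le _ _ _).trans ((degreeOf_pow_le _ _ _).trans ?_)
  rw [degreeOf_X, if_pos rfl, mul_one]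
  exact Nat.lt_succ_iff.1 (Finset.mem_range.1 hj)

theorem degreeOf_aeval_X_of_ne {K : Type*} [Field K] {i j : Fin 2} (hij : i ≠ j)
    (a : Polynomial K) :
    degreeOf i (Polynomial.aeval (X j : MvPolynomial (Fin 2) K) a) = 0 := by
  rw [← Nat.le_zero, Polynomial.aeval_eq_sum_range]
  refine (degreeOf_sum_le _ _ _).trans (Finset.sup_le fun n _ => ?_)
  rw [smul_eq_C_mul]
  refine (degreeOf_C_mul_le _ _ _).trans ((degreeOf_pow_le _ _ _).trans ?_)
  rw [degreeOf_X_of_ne hij, mul_zero]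

/-- A multiple of `p` of bidegree at most `(k, l)` has a bi-homogenization that vanishes wherever
that of `p` does. -/
theorem bihomEval_eq_zero_of_dvd {K : Type*} [Field K] {p Q : MvPolynomial (Fin 2) K} (h : p ∣ Q)
    {k l : ℕ} (hk : degreeOf 0 Q ≤ k) (hl : degreeOf 1 Q ≤ l) {v w : Fin 2 → K}
    (hp : eval (Sum.elim v w) (bihom p) = 0) : bihomEval k l v w Q = 0 := by
  rcases eq_or_ne Q 0 with rfl | hQ
  · exact map_zero _
  obtain ⟨R, rfl⟩ := h
  have h₀ := degreeOf_mul_eq (n := 0) (left_ne_zero_of_mul hQ) (right_ne_zero_of_mul hQ)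
  have h₁ := degreeOf_mul_eq (n := 1) (left_ne_zero_of_mul hQ) (right_ne_zero_of_mul hQ)
  obtain ⟨k', rfl⟩ := Nat.exists_eq_add_of_le (show degreeOf 0 p ≤ k by omega)
  obtain ⟨l', rfl⟩ := Nat.exists_eq_add_of_le (show degreeOf 1 p ≤ l by omega)
  rw [bihomEval_mul v w le_rfl le_rfl (by omega) (by omega), ← eval_bihom, hp, zero_mul]

/-! ### Poles -/

/-- The degree of a rational function as a self-map of the projective line. -/
noncomputable def ratDegree {K : Type*} [Field K] (f : RatFunc K) : ℕ :=
  max f.num.natDegree f.denom.natDegree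

theorem natDegree_num_le_ratDegree {K : Type*} [Field K] (f : RatFunc K) :
    f.num.natDegree ≤ ratDegree f :=
  le_max_left _ _

theorem natDegree_denom_le_ratDegree {K : Type*} [Field K] (f : RatFunc K) :
    f.denom.natDegree ≤ ratDegree f :=
  le_max_right _ _

theorem finPt_injective {K : Type*} [Field K] : Function.Injective (finPt : K → P1 K) := by
  intro s t h
  obtain ⟨a, ha⟩ := (Projectivization.mk_eq_mk_iff' K _ _ _ _).1 h
  have h0 : a = 1 := by simpa using congrFun ha 0
  simpa [h0] using (congrFun ha 1).symm

theorem finPt_ne_inftyPt {K : Type*} [Field K] (s : K) : finPt s ≠ inftyPt K := by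
  intro h
  obtain ⟨a, ha⟩ := (Projectivization.mk_eq_mk_iff' K _ _ _ _).1 h
  simpa using congrFun ha 0

theorem eq_inftyPt_or_finPt {K : Type*} [Field K] (P : P1 K) :
    P = inftyPt K ∨ ∃ s, P = finPt s := by
  induction P using Projectivization.ind with
  | h v hv =>
    by_cases h0 : v 0 = 0
    · refine Or.inl ((Projectivization.mk_eq_mk_iff' K _ _ _ _).2 ⟨v 1, ?_⟩)
      ext i
      fin_cases i <;> simp [h0]
    · refine Or.inr ⟨v 1 / v 0, (Projectivization.mk_eq_mk_iff' K _ _ _ _).2 ⟨v 0, ?_⟩⟩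
      ext i
      fin_cases i <;> simp [mul_div_cancel₀, h0]

theorem isPole_finPt {K : Type*} [Field K] {f : RatFunc K} {s : K} :
    IsPole f (finPt s) ↔ f.denom.eval s = 0 := by
  constructor
  · rintro (⟨t, ht, h⟩ | ⟨h, -⟩)
    · rwa [finPt_injective ht]
    · exact absurd h (finPt_ne_inftyPt s)
  · exact fun h => Or.inl ⟨s, rfl, h⟩

theorem isPole_inftyPt {K : Type*} [Field K] {f : RatFunc K} :
    IsPole f (inftyPt K) ↔ f.denom.natDegree < f.num.natDegree := by
  constructor
  · rintro (⟨t, ht, -⟩ | ⟨-, h⟩)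
    · exact absurd ht.symm (finPt_ne_inftyPt t)
    · exact h
  · exact fun h => Or.inr ⟨rfl, h⟩

theorem finite_setOf_isPole {K : Type*} [Field K] (f : RatFunc K) : {P | IsPole f P}.Finite := by
  refine (((f.denom.finite_setOfPred_isRoot f.denom_ne_zero).image finPt).insert (inftyPt K)).subset ?_
  rintro P (⟨s, rfl, h⟩ | ⟨rfl, -⟩)
  · exact Or.inr ⟨s, h, rfl⟩
  · exact Or.inl rfl

/-- Each point has homogeneous coordinates at which the poles of all rational functions are
detected by the homogenized denominator; the homogenized numerator does not vanish at a pole. -/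
theorem exists_homEval_denom_eq_zero_iff {K : Type*} [Field K] (P : P1 K) :
    ∃ (v : Fin 2 → K) (hv : v ≠ 0), P = Projectivization.mk K v hv ∧ ∀ f : RatFunc K,
      (IsPole f P ↔ homEval (ratDegree f) v f.denom = 0) ∧
      (IsPole f P → homEval (ratDegree f) v f.num ≠ 0) := by
  rcases eq_inftyPt_or_finPt P with rfl | ⟨s, rfl⟩
  · refine ⟨_, _, rfl, fun f => ?_⟩
    rw [isPole_inftyPt, homEval_infty, homEval_infty, ratDegree]
    refine ⟨⟨fun h => ?_, fun h => ?_⟩, fun h => ?_⟩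
    · rw [max_eq_left h.le]
      exact Polynomial.coeff_eq_zero_of_natDegree_lt h
    · by_contra! hle
      rw [max_eq_right hle] at h
      exact f.denom_ne_zero (Polynomial.leadingCoeff_eq_zero.1 h)
    · rw [max_eq_left h.le]
      intro h0
      rw [Polynomial.leadingCoeff_eq_zero.1 h0, Polynomial.natDegree_zero] at h
      exact Nat.not_lt_zero _ h
  · refine ⟨_, _, rfl, fun f => ?_⟩
    rw [isPole_finPt, homEval_finite (natDegree_denom_le_ratDegree f),
      homEval_finite (natDegree_num_le_ratDegree f)]
    refine ⟨Iff.rfl, fun hd hn => ?_⟩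
    obtain ⟨a, b, hab⟩ := f.isCoprime_num_denom
    simpa [hd, hn] using congrArg (Polynomial.eval s) hab

/-! ### Separated multiples on the curve -/

theorem incl_eq_div {K : Type*} [Field K] (i : Fin 2) (f : RatFunc K) :
    incl K i f = algebraMap (MvPolynomial (Fin 2) K) (RatFunc₂ K) (Polynomial.aeval (X i) f.num)
      / algebraMap (MvPolynomial (Fin 2) K) (RatFunc₂ K) (Polynomial.aeval (X i) f.denom) :=
  RatFunc.liftAlgHom_apply _ _ f

theorem dvd_of_mem_sepMultiples {K : Type*} [Field K] {p : MvPolynomial (Fin 2) K}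
    {hp : Admissible p} {u : RatFunc K × RatFunc K} (hu : u ∈ sepMultiples hp) :
    p ∣ Polynomial.aeval (X 0) u.1.num * Polynomial.aeval (X 1) u.2.denom
      - Polynomial.aeval (X 0) u.1.denom * Polynomial.aeval (X 1) u.2.num := by
  obtain ⟨q, ⟨a, b, hb, rfl⟩, h⟩ := hu
  have hne : ∀ {c : MvPolynomial (Fin 2) K}, ¬ p ∣ c → algebraMap _ (RatFunc₂ K) c ≠ 0 := by
    intro c hc
    simpa using fun h : c = 0 => hc (h ▸ dvd_zero p)
  have hb0 := hne hb
  have h1 := hne (hp.not_dvd_aeval_X 0 u.1.denom_ne_zero)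
  have h2 := hne (hp.not_dvd_aeval_X 1 u.2.denom_ne_zero)
  rw [incl_eq_div, incl_eq_div, div_sub_div _ _ h1 h2, div_mul_eq_mul_div,
    div_eq_div_iff (mul_ne_zero h1 h2) hb0] at h
  simp only [← map_mul, ← map_sub] at h
  have h' := IsFractionRing.injective (MvPolynomial (Fin 2) K) (RatFunc₂ K) h
  refine (hp.irreducible.prime.dvd_or_dvd (?_ : p ∣ _ * b)).resolve_right hb
  rw [h']
  exact (dvd_mul_left p a).mul_right _

/-- The identity `f(a) = g(b)` in `ℙ¹`, for `(f, g)` in `F(p)` and a point `(a, b)` of the curve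
with homogeneous coordinates `v` and `w`. -/
theorem cross_mul_eq_of_mem_curve {K : Type*} [Field K] {p : MvPolynomial (Fin 2) K}
    {hp : Admissible p} {u : RatFunc K × RatFunc K} (hu : u ∈ sepMultiples hp) {v w : Fin 2 → K}
    (h : eval (Sum.elim v w) (bihom p) = 0) :
    homEval (ratDegree u.1) v u.1.num * homEval (ratDegree u.2) w u.2.denom
      = homEval (ratDegree u.1) v u.1.denom * homEval (ratDegree u.2) w u.2.num := by
  rw [← sub_eq_zero, ← bihomEval_aeval_mul_aeval v w (natDegree_num_le_ratDegree u.1)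
      (natDegree_denom_le_ratDegree u.2),
    ← bihomEval_aeval_mul_aeval v w (natDegree_denom_le_ratDegree u.1)
      (natDegree_num_le_ratDegree u.2), ← map_sub]
  have h₀ : ∀ a b : Polynomial K, degreeOf 0 (Polynomial.aeval (X 0 : MvPolynomial (Fin 2) K) a
      * Polynomial.aeval (X 1) b) ≤ a.natDegree := fun a b =>
    (degreeOf_mul_le _ _ _).trans (by
      rw [degreeOf_aeval_X_of_ne zero_ne_one, add_zero]
      exact degreeOf_aeval_X_le 0 a)
  have h₁ : ∀ a b : Polynomial K, degreeOf 1 (Polynomial.aeval (X 0 : MvPolynomial (Fin 2) K) a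
      * Polynomial.aeval (X 1) b) ≤ b.natDegree := fun a b =>
    (degreeOf_mul_le _ _ _).trans (by
      rw [degreeOf_aeval_X_of_ne one_ne_zero, zero_add]
      exact degreeOf_aeval_X_le 1 b)
  refine bihomEval_eq_zero_of_dvd (dvd_of_mem_sepMultiples hu) ?_ ?_ h
  · exact (degreeOf_sub_le _ _ _).trans (max_le_max (h₀ _ _) (h₀ _ _))
  · exact (degreeOf_sub_le _ _ _).trans
      (max_le ((h₁ _ _).trans (le_max_right _ _)) ((h₁ _ _).trans (le_max_left _ _)))

theorem isPole_iff_of_mem_curve {K : Type*} [Field K] {p : MvPolynomial (Fin 2) K}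
    {hp : Admissible p} {u : RatFunc K × RatFunc K} (hu : u ∈ sepMultiples hp)
    {P : P1 K × P1 K} (hP : P ∈ curve p) : IsPole u.1 P.1 ↔ IsPole u.2 P.2 := by
  obtain ⟨a, b⟩ := P
  obtain ⟨v, hv, rfl, hvf⟩ := exists_homEval_denom_eq_zero_iff a
  obtain ⟨w, hw, rfl, hwg⟩ := exists_homEval_denom_eq_zero_iff b
  have h := cross_mul_eq_of_mem_curve hu ((mk_mem_curve p hv hw).1 hP)
  obtain ⟨hf, hf'⟩ := hvf u.1
  obtain ⟨hg, hg'⟩ := hwg u.2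
  constructor
  · intro hpole
    rw [hf.1 hpole, zero_mul] at h
    exact hg.2 ((mul_eq_zero.1 h).resolve_left (hf' hpole))
  · intro hpole
    rw [hg.1 hpole, mul_zero] at h
    exact hf.2 ((mul_eq_zero.1 h.symm).resolve_right (hg' hpole))

theorem isPole_iff_of_orbitRel {K : Type*} [Field K] {p : MvPolynomial (Fin 2) K}
    {hp : Admissible p} {u : RatFunc K × RatFunc K} (hu : u ∈ sepMultiples hp) {P Q : curve p}
    (h : OrbitRel p P Q) : IsPole u.1 P.1.1 ↔ IsPole u.1 Q.1.1 := by
  induction h with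
  | rel P Q h =>
    rcases h with h | h
    · rw [h]
    · rw [isPole_iff_of_mem_curve hu P.2, h, isPole_iff_of_mem_curve hu Q.2]
  | refl => exact Iff.rfl
  | symm _ _ _ ih => exact ih.symm
  | trans _ _ _ _ _ ih₁ ih₂ => exact ih₁.trans ih₂

/-! ### Generators -/

/-- The embedding of `F(p)` into `K(x)`. -/
noncomputable def fstHom {K : Type*} [Field K] {p : MvPolynomial (Fin 2) K} (hp : Admissible p) :
    sepMultiples hp →ₐ[K] RatFunc K :=
  (AlgHom.fst K (RatFunc K) (RatFunc K)).comp (sepMultiples hp).val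

theorem exists_isGenerator {K : Type*} [Field K] {p : MvPolynomial (Fin 2) K}
    (hp : Admissible p) : ∃ u : sepMultiples hp, IsGenerator u := by
  obtain ⟨u, hu⟩ : RatFunc.Luroth.generator (fstHom hp).fieldRange ∈ (fstHom hp).fieldRange :=
    RatFunc.Luroth.generator_mem
  refine ⟨u, IntermediateField.map_injective (fstHom hp) ?_⟩
  have hu' : fstHom hp u = RatFunc.Luroth.generator (fstHom hp).fieldRange := hu
  rw [IntermediateField.adjoin_map, Set.image_singleton, hu',
    ← RatFunc.Luroth.eq_adjoin_generator, AlgHom.fieldRange_eq_map]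

theorem IsGenerator.notMem_range {K : Type*} [Field K] {p : MvPolynomial (Fin 2) K}
    {hp : Admissible p} (hF : IsEmpty (sepMultiples hp ≃ₐ[K] K)) {u : sepMultiples hp}
    (hu : IsGenerator u) (c : K) : u ≠ algebraMap K (sepMultiples hp) c := by
  rintro rfl
  have htop : (⊥ : IntermediateField K (sepMultiples hp)) = ⊤ := by
    rw [← hu, eq_comm, IntermediateField.adjoin_simple_eq_bot_iff]
    exact IntermediateField.algebraMap_mem _ c
  exact hF.false ((IntermediateField.topEquiv.symm.trans
    (IntermediateField.equivOfEq htop.symm)).trans (IntermediateField.botEquiv K _))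

theorem IsGenerator.inv_sub_algebraMap {K : Type*} [Field K] {p : MvPolynomial (Fin 2) K}
    {hp : Admissible p} {u : sepMultiples hp} (hu : IsGenerator u) (c : K) :
    IsGenerator (u - algebraMap K (sepMultiples hp) c)⁻¹ := by
  rw [IsGenerator, eq_top_iff, ← hu, IntermediateField.adjoin_simple_le_iff]
  have h := inv_mem (IntermediateField.mem_adjoin_simple_self K
    (u - algebraMap K (sepMultiples hp) c)⁻¹)
  rw [inv_inv] at h
  simpa using add_mem h (IntermediateField.algebraMap_mem _ c)

/-- A rational function that is regular at `∞` takes a value `c` there, and `f - c` vanishes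
at `∞`. -/
theorem exists_intDegree_sub_C_neg {K : Type*} [Field K] {f : RatFunc K}
    (hf : f.num.natDegree ≤ f.denom.natDegree) (hc : ∀ c, f - algebraMap K (RatFunc K) c ≠ 0) :
    ∃ c, (f - algebraMap K (RatFunc K) c).intDegree < 0 := by
  rcases hf.lt_or_eq with hlt | heq
  · refine ⟨0, ?_⟩
    rw [map_zero, sub_zero, RatFunc.intDegree]
    omega
  · have hd : algebraMap (Polynomial K) (RatFunc K) f.denom ≠ 0 :=
      RatFunc.algebraMap_ne_zero f.denom_ne_zero
    set c := f.num.leadingCoeff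
    have heq' : f - algebraMap K (RatFunc K) c
        = algebraMap _ _ (f.num - Polynomial.C c * f.denom) / algebraMap _ _ f.denom := by
      conv_lhs => rw [← f.num_div_denom]
      rw [map_sub, map_mul, sub_div, mul_div_assoc, div_self hd, mul_one]
      rfl
    have hne : f.num - Polynomial.C c * f.denom ≠ 0 := by
      intro h
      apply hc c
      rw [heq', h, map_zero, zero_div]
    have hn0 : f.num ≠ 0 := RatFunc.num_ne_zero (by simpa using hc 0)
    have hc0 : c ≠ 0 := Polynomial.leadingCoeff_ne_zero.2 hn0
    refine ⟨c, ?_⟩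
    rw [heq', RatFunc.intDegree_div (RatFunc.algebraMap_ne_zero hne) hd,
      RatFunc.intDegree_polynomial, RatFunc.intDegree_polynomial]
    have hlt : (f.num - Polynomial.C c * f.denom).natDegree < f.num.natDegree := by
      refine Polynomial.natDegree_lt_natDegree hne (Polynomial.degree_sub_lt_left ?_ hn0 ?_)
      · rw [Polynomial.degree_C_mul hc0]
        rw [Polynomial.degree_eq_natDegree hn0, Polynomial.degree_eq_natDegree f.denom_ne_zero, heq]
      · rw [Polynomial.leadingCoeff_mul, Polynomial.leadingCoeff_C, f.monic_denom.leadingCoeff,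
          mul_one]
    omega

theorem exists_isGenerator_isPole_inftyPt {K : Type*} [Field K] {p : MvPolynomial (Fin 2) K}
    {hp : Admissible p} (hF : IsEmpty (sepMultiples hp ≃ₐ[K] K)) :
    ∃ u : sepMultiples hp, IsGenerator u ∧ IsPole u.1.1 (inftyPt K) := by
  obtain ⟨u, hu⟩ := exists_isGenerator hp
  rcases lt_or_ge u.1.1.denom.natDegree u.1.1.num.natDegree with hlt | hle
  · exact ⟨u, hu, isPole_inftyPt.2 hlt⟩
  obtain ⟨c, hc⟩ := exists_intDegree_sub_C_neg hle fun c h =>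
    hu.notMem_range hF c ((fstHom hp).injective
      ((sub_eq_zero.1 h).trans ((fstHom hp).commutes c).symm))
  refine ⟨_, hu.inv_sub_algebraMap c, isPole_inftyPt.2 ?_⟩
  have h := RatFunc.intDegree_inv (u.1.1 - algebraMap K (RatFunc K) c)
  have h' : (0 : ℤ) < ((u.1.1 - algebraMap K (RatFunc K) c)⁻¹).intDegree := by omega
  rw [RatFunc.intDegree, sub_pos, Nat.cast_lt] at h'
  exact h'

end SepVar

theorem mainTheorem2 {K : Type*} [Field K] [IsAlgClosed K] [CharZero K]
    (p : MvPolynomial (Fin 2) K) (hp : SepVar.Admissible p)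
    (hF : IsEmpty (SepVar.sepMultiples hp ≃ₐ[K] K)) :
    (∃ u : SepVar.sepMultiples hp, SepVar.IsGenerator u ∧
      ∀ P ∈ SepVar.orbitAtInfty p,
        SepVar.IsPole u.1.1 P.1 ∧ SepVar.IsPole u.1.2 P.2) ∧
    (SepVar.orbitAtInfty p).Finite := by
  obtain ⟨u, hu, hinf⟩ := SepVar.exists_isGenerator_isPole_inftyPt hF
  have hpole : ∀ P ∈ SepVar.orbitAtInfty p,
      SepVar.IsPole u.1.1 P.1 ∧ SepVar.IsPole u.1.2 P.2 := by
    rintro P ⟨hP, Q, hQ, hQP⟩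
    have h := (SepVar.isPole_iff_of_orbitRel u.2 hQP).1 (hQ ▸ hinf)
    exact ⟨h, (SepVar.isPole_iff_of_mem_curve u.2 hP).1 h⟩
  exact ⟨⟨u, hu, hpole⟩, ((SepVar.finite_setOf_isPole u.1.1).prod
    (SepVar.finite_setOf_isPole u.1.2)).subset hpole⟩
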